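/- **Notation.** For a topological space $X$ let $C_2(X)=\{(x,y)\in X\times X : x\ne y\}$, with the involution $\sigma(x,y)=(y,x)$. Let $H^2(C_2(X),\sigma)$ be the second integral cohomology group of the subcomplex $\operatorname{Ker}(1+\sigma_\sharp)$ of the singular chain complex of $C_2(X)$. An injective continuous map $g:X\to Y$ induces $(g\times g)^*:H^2(C_2(Y),\sigma)\to H^2(C_2(X),\sigma)$. Fix a generator $\Sigma$ of $H^2(C_2(\mathbb R^3),\sigma)\cong\mathbb Z$. Let $G$ be a finite graph with oriented edges. Let $Z(G)$ be the free $\mathbb Z$-module on the symbols $E^{e,e'}=E^{e',e}$, one for each unordered pair of disjoint edges of $G$. For an edge $e$ and a vertex $v$ not on $e$, let $\delta(V^{e,v})$ be the sum of the $E^{e,e'}$ over the edges $e'$ disjoint from $e$ with initial vertex $v$, minus the sum of the $E^{e,e'}$ over the edges $e'$ disjoint from $e$ with terminal vertex $v$. Let $B(G)\subseteq Z(G)$ be the submodule generated by all the $\delta(V^{e,v})$. The linking module of $G$ is $L(G)=Z(G)/B(G)$. It is identified with $H^2(C_2(G),\sigma)$ by $$\Psi_G:H^2(C_2(G),\sigma)\to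 L(G),\qquad [c]\mapsto\Big[\sum_{\{e,e'\}} c(e\times e'+e'\times e)\,E^{e,e'}\Big],$$ where the sum is over the unordered pairs of disjoint edges, $e\times e'$ is the product square, as a singular chain of $C_2(G)$, and $e\times e'+e'\times e=(1-\sigma_\sharp)(e\times e')$. Let $f$ be an embedding of $G$ in $S^3$. Choose a point $p\in S^3\setminus f(G)$ and a homeomorphism $S^3\setminus\{p\}\cong\mathbb R^3$, and so regard $f$ as a map to $\mathbb R^3$. The Wu invariant of $f$ is $\mathcal L(f)=\Psi_G((f\times f)^*\Sigma)\in L(G)$. For a homomorphism $\varepsilon:L(G)\to\mathbb Z$, the integer $\tilde{\mathcal L}_\varepsilon(f)=\varepsilon(\mathcal L(f))$ is the reduced Wu invariant of $f$ with respect to $\varepsilon$. **Theorem.** Let $G$ be a finite graph with oriented edges, and let $G_1,\dots,G_k$ be subgraphs of $G$ with the orientations inherited from $G$ and inclusion maps $i_q:G_q\to G$. Let $(i_q\times i_q)^*:L(G)\to L(G_q)$ be the homomorphism that sends $[E^{e,e'}]$ to $[E^{e,e'}]$ if $e$ and $e'$ are both edges of $G_q$, and to $0$ otherwise. For each $q$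 this is the homomorphism that the inclusion induces on cohomology: $(i_q\times i_q)^*(\Psi_G(x))=\Psi_{G_q}((i_q\times i_q)^*x)$ for all $x\in H^2(C_2(G),\sigma)$. For each $q$ let $\varepsilon_q:L(G_q)\to\mathbb Z$ be a homomorphism and let $m_q$ be an integer. Let $\varepsilon:L(G)\to\mathbb Z$ be the homomorphism $$\varepsilon=\sum_{q=1}^k m_q\,\varepsilon_q\circ(i_q\times i_q)^*.$$ Then for every embedding $f$ of $G$ in $S^3$ (with the same, arbitrary, choice of $p$ and of $S^3\setminus\{p\}\cong\mathbb R^3$ for $f$ and for all its restrictions), $$\sum_{q=1}^k m_q\,\tilde{\mathcal L}_{\varepsilon_q}(f|_{G_q})=\tilde{\mathcal L}_{\varepsilon}(f).$$ That is, every integer combination of reduced Wu invariants of subgraphs of $G$ is a reduced Wu invariant of $G$. -/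

import Mathlib

open Topology

noncomputable section

namespace SpatialGraph

/-! ### Singular chains with integer coefficients -/

/-- Singular `n`-simplices of `X`. -/
abbrev SingSimplex (n : ℕ) (X : Type*) [TopologicalSpace X] :=
  C(stdSimplex ℝ (Fin (n + 1)), X)

/-- The integral singular `n`-chains of `X`. -/
abbrev SingChain (n : ℕ) (X : Type*) [TopologicalSpace X] := SingSimplex n X →₀ ℤ

section Chains

variable {X Y : Type*} [TopologicalSpace X] [TopologicalSpace Y]

/-- The `i`-th face of a singular simplex. -/
def face {n : ℕ} (i : Fin (n + 2)) (s : SingSimplex (n + 1) X) : SingSimplex n X :=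
  s.comp ⟨stdSimplex.map i.succAbove, stdSimplex.continuous_map _⟩

/-- The singular boundary operator `∂ s = ∑ i, (-1)^i • (i-th face of s)`. -/
def boundary (n : ℕ) (X : Type*) [TopologicalSpace X] :
    SingChain (n + 1) X →ₗ[ℤ] SingChain n X :=
  Finsupp.linearCombination ℤ fun s : SingSimplex (n + 1) X =>
    ∑ i : Fin (n + 2), Finsupp.single (face i s) ((-1 : ℤ) ^ (i : ℕ))

/-- The map on singular chains induced by a continuous map. -/
def chainMap (n : ℕ) (f : C(X, Y)) : SingChain n X →ₗ[ℤ] SingChain n Y :=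
  Finsupp.lmapDomain ℤ ℤ fun s : SingSimplex n X => f.comp s

lemma chainMap_single {n : ℕ} (f : C(X, Y)) (s : SingSimplex n X) (a : ℤ) :
    chainMap n f (Finsupp.single s a) = Finsupp.single (f.comp s) a := by
  simp [chainMap]

lemma boundary_single {n : ℕ} (s : SingSimplex (n + 1) X) :
    boundary n X (Finsupp.single s 1) =
      ∑ i : Fin (n + 2), Finsupp.single (face i s) ((-1 : ℤ) ^ (i : ℕ)) := by
  simp [boundary]

lemma boundary_chainMap {n : ℕ} (f : C(X, Y)) (c : SingChain (n + 1) X) :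
    boundary n Y (chainMap (n + 1) f c) = chainMap n f (boundary n X c) := by
  suffices h : (boundary n Y).comp (chainMap (n + 1) f) =
      (chainMap n f).comp (boundary n X) from LinearMap.congr_fun h c
  refine Finsupp.lhom_ext' fun s => LinearMap.ext_ring ?_
  simp only [LinearMap.comp_apply, Finsupp.lsingle_apply, chainMap_single, boundary_single,
    map_sum]
  rfl

lemma chainMap_comm {Z W : Type*} [TopologicalSpace Z] [TopologicalSpace W] {n : ℕ}
    {f : C(X, Y)} {g : C(Y, W)} {f' : C(X, Z)} {g' : C(Z, W)}
    (h : g.comp f = g'.comp f') (c : SingChain n X) :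
    chainMap n g (chainMap n f c) = chainMap n g' (chainMap n f' c) := by
  suffices h : (chainMap n g).comp (chainMap n f) =
      (chainMap n g').comp (chainMap n f') from LinearMap.congr_fun h c
  refine Finsupp.lhom_ext' fun s => LinearMap.ext_ring ?_
  simp only [LinearMap.comp_apply, Finsupp.lsingle_apply, chainMap_single]
  rw [← ContinuousMap.comp_assoc, h, ContinuousMap.comp_assoc]

end Chains

/-! ### Configuration spaces and skew-symmetric cohomology -/

/-- The configuration space `C₂(X)` of ordered pairs of distinct points of `X`. -/
abbrev Conf (X : Type*) := {p : X × X // p.1 ≠ p.2}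

section Config

variable {X Y : Type*} [TopologicalSpace X] [TopologicalSpace Y]

/-- The involution `σ (x, y) = (y, x)` of `C₂(X)`. -/
def swap (X : Type*) [TopologicalSpace X] : C(Conf X, Conf X) where
  toFun p := ⟨(p.1.2, p.1.1), p.2.symm⟩
  continuous_toFun := by fun_prop

/-- The map `f × f : C₂(X) → C₂(Y)` induced by an injective continuous map `f : X → Y`. -/
def confMap (f : C(X, Y)) (hf : Function.Injective f) : C(Conf X, Conf Y) where
  toFun p := ⟨(f p.1.1, f p.1.2), fun h => p.2 (hf h)⟩
  continuous_toFun := by fun_prop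

/-- The subcomplex `Ker (1 + σ_♯)` of the singular chain complex of `C₂(X)`, in degree `n`. -/
def skewChain (X : Type*) [TopologicalSpace X] (n : ℕ) : Submodule ℤ (SingChain n (Conf X)) :=
  LinearMap.ker (LinearMap.id + chainMap n (swap X))

lemma mem_skewChain {n : ℕ} {c : SingChain n (Conf X)} :
    c ∈ skewChain X n ↔ c + chainMap n (swap X) c = 0 := Iff.rfl

/-- The boundary operator of `Ker (1 + σ_♯)`. -/
def skewBoundary (X : Type*) [TopologicalSpace X] (n : ℕ) :
    skewChain X (n + 1) →ₗ[ℤ] skewChain X n :=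
  (boundary n (Conf X)).restrict fun c hc => by
    rw [mem_skewChain] at hc ⊢
    rw [← boundary_chainMap, ← map_add, hc, map_zero]

/-- Integral cochains on `Ker (1 + σ_♯)`. -/
abbrev SkewCochain (X : Type*) [TopologicalSpace X] (n : ℕ) := skewChain X n →ₗ[ℤ] ℤ

/-- The coboundary operator `c ↦ c ∘ ∂`. -/
def coboundary (X : Type*) [TopologicalSpace X] (n : ℕ) :
    SkewCochain X n →ₗ[ℤ] SkewCochain X (n + 1) :=
  LinearMap.lcomp ℤ ℤ (skewBoundary X n)

/-- The `2`-cocycles on `Ker (1 + σ_♯)`. -/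
def cocycles (X : Type*) [TopologicalSpace X] : Submodule ℤ (SkewCochain X 2) :=
  LinearMap.ker (coboundary X 2)

/-- The second skew-symmetric integral cohomology group `H²(C₂(X), σ)`: the second integral
cohomology of the complex `Ker (1 + σ_♯)`, that is, cocycles modulo coboundaries. -/
abbrev SkewH2 (X : Type*) [TopologicalSpace X] :=
  cocycles X ⧸ (LinearMap.range (coboundary X 1)).submoduleOf (cocycles X)

/-- The restriction of `(f × f)_♯` to `Ker (1 + σ_♯)`. -/
def skewMap (n : ℕ) (f : C(X, Y)) (hf : Function.Injective f) :
    skewChain X n →ₗ[ℤ] skewChain Y n :=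
  (chainMap n (confMap f hf)).restrict fun c hc => by
    rw [mem_skewChain] at hc ⊢
    rw [chainMap_comm (f := confMap f hf) (g := swap Y) (f' := swap X) (g' := confMap f hf) rfl,
      ← map_add, hc, map_zero]

lemma skewBoundary_skewMap (n : ℕ) (f : C(X, Y)) (hf : Function.Injective f)
    (c : skewChain X (n + 1)) :
    skewBoundary Y n (skewMap (n + 1) f hf c) = skewMap n f hf (skewBoundary X n c) :=
  Subtype.ext (boundary_chainMap _ _)

/-- The homomorphism `(f × f)^* : H²(C₂(Y), σ) → H²(C₂(X), σ)`. -/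
def pullback (f : C(X, Y)) (hf : Function.Injective f) : SkewH2 Y →ₗ[ℤ] SkewH2 X :=
  Submodule.mapQ _ _
    ((LinearMap.lcomp ℤ ℤ (skewMap 2 f hf)).restrict fun c hc => by
      refine LinearMap.ext fun x => ?_
      change c (skewMap 2 f hf (skewBoundary X 2 x)) = 0
      rw [← skewBoundary_skewMap]
      exact LinearMap.congr_fun hc _)
    (by
      rintro ⟨c, hc⟩ ⟨b, hb⟩
      refine ⟨b ∘ₗ skewMap 1 f hf, LinearMap.ext fun x => ?_⟩
      change b (skewMap 1 f hf (skewBoundary X 1 x)) = c (skewMap 2 f hf x)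
      rw [← skewBoundary_skewMap]
      exact LinearMap.congr_fun hb _)

end Config

/-! ### Oriented graphs and their linking modules -/

/-- A graph with vertex set `V` and edge set `E` (loops and multiple edges are allowed), each
edge oriented from its initial to its terminal vertex. -/
structure OrientedGraph (V E : Type*) where
  init : E → V
  term : E → V

namespace OrientedGraph

variable {V E : Type*} (G : OrientedGraph V E)

/-- The vertex `v` is an end of the edge `e`. -/
def Incident (e : E) (v : V) : Prop := v = G.init e ∨ v = G.term e

/-- The edges `e` and `k` are disjoint: they have no common vertex. -/
def DisjointEdges (e k : E) : Prop := ∀ v, G.Incident e v → ¬ G.Incident k v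

lemma disjoint_symm : Std.Symm G.DisjointEdges := ⟨fun _ _ h v hk he => h v he hk⟩

/-- The unordered pairs of disjoint edges. -/
def disjointPairs : Set (Sym2 E) := Sym2.fromRel G.disjoint_symm

/-- The free module `Z(G)` on the unordered pairs of disjoint edges. -/
abbrev Z := G.disjointPairs →₀ ℤ

open Classical in
/-- The generator `E^{e,k}` of `Z(G)` if `e` and `k` are disjoint; zero otherwise. -/
def gen (e k : E) : G.Z :=
  if h : s(e, k) ∈ G.disjointPairs then Finsupp.single ⟨s(e, k), h⟩ 1 else 0

/-- `δ(V^{e,v})`: the sum of the `E^{e,k}` over the edges `k` that are disjoint from `e` and have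
initial vertex `v`, minus the same sum over those that have terminal vertex `v`. -/
def delta (e : E) (v : V) : G.Z :=
  (∑ᶠ (k : E) (_ : G.init k = v), G.gen e k) - ∑ᶠ (k : E) (_ : G.term k = v), G.gen e k

/-- The submodule `B(G)` of `Z(G)` generated by the `δ(V^{e,v})`, `v` not on `e`. -/
def B : Submodule ℤ G.Z :=
  Submodule.span ℤ {z | ∃ e v, ¬ G.Incident e v ∧ z = G.delta e v}

/-- The linking module `L(G) = Z(G) / B(G)`. -/
abbrev LinkingModule := G.Z ⧸ G.B

/-- A subgraph: sets of vertices and edges, containing the ends of each of its edges. -/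
structure Subgraph where
  verts : Set V
  edges : Set E
  init_mem : ∀ e ∈ edges, G.init e ∈ verts
  term_mem : ∀ e ∈ edges, G.term e ∈ verts

variable {G}

/-- A subgraph as an oriented graph, with the inherited orientations. -/
def Subgraph.toGraph (H : G.Subgraph) : OrientedGraph H.verts H.edges where
  init e := ⟨G.init e, H.init_mem e e.2⟩
  term e := ⟨G.term e, H.term_mem e e.2⟩

lemma Subgraph.incident_iff (H : G.Subgraph) (e : H.edges) (v : H.verts) :
    H.toGraph.Incident e v ↔ G.Incident e v := by
  simp [Incident, toGraph, Subtype.ext_iff]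

lemma Subgraph.disjoint_iff (H : G.Subgraph) (e k : H.edges) :
    H.toGraph.DisjointEdges e k ↔ G.DisjointEdges e k := by
  constructor
  · intro h v he hk
    have hv : v ∈ H.verts := by
      rcases he with rfl | rfl
      exacts [H.init_mem e e.2, H.term_mem e e.2]
    exact h ⟨v, hv⟩ ((H.incident_iff e ⟨v, hv⟩).2 he) ((H.incident_iff k ⟨v, hv⟩).2 hk)
  · intro h v he hk
    exact h v ((H.incident_iff e v).1 he) ((H.incident_iff k v).1 hk)

/-- A pair of disjoint edges of a subgraph, as a pair of disjoint edges of the graph. -/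
def Subgraph.pairIncl (H : G.Subgraph) (p : H.toGraph.disjointPairs) : G.disjointPairs :=
  ⟨p.1.map Subtype.val, by
    obtain ⟨p, hp⟩ := p
    induction p with
    | _ a b => exact (H.disjoint_iff a b).1 hp⟩

lemma Subgraph.pairIncl_injective (H : G.Subgraph) : Function.Injective H.pairIncl :=
  fun _ _ h => Subtype.ext (Sym2.map.injective Subtype.val_injective (congrArg Subtype.val h))

/-- The homomorphism `Z(G) → Z(H)` that fixes `E^{e,k}` if `e` and `k` are edges of `H`, and
sends it to zero otherwise. -/
def Subgraph.zRestrict (H : G.Subgraph) : G.Z →ₗ[ℤ] H.toGraph.Z :=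
  Finsupp.lcomapDomain H.pairIncl H.pairIncl_injective

lemma gen_apply (e k : E) (p : G.disjointPairs) [Decidable (s(e, k) = p.1)] :
    G.gen e k p = if s(e, k) = p.1 then 1 else 0 := by
  classical
  unfold gen
  split_ifs with h1 h2 h2
  · rw [Finsupp.single_apply, if_pos (Subtype.ext h2)]
  · rw [Finsupp.single_apply, if_neg fun h => h2 (congrArg Subtype.val h)]
  · exact absurd (h2 ▸ p.2) h1
  · rfl

open Classical in
lemma delta_eq_sum [Fintype E] (e : E) (v : V) :
    G.delta e v = ∑ k, (((if G.init k = v then (1 : ℤ) else 0) -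
      (if G.term k = v then 1 else 0)) • G.gen e k) := by
  unfold delta
  rw [finsum_eq_sum_of_fintype, finsum_eq_sum_of_fintype, ← Finset.sum_sub_distrib]
  refine Finset.sum_congr rfl fun k _ => ?_
  rw [finsum_eq_if, finsum_eq_if, sub_smul, ite_smul, ite_smul]
  simp

lemma ne_of_disjoint {a b : E} (h : G.DisjointEdges a b) : a ≠ b := by
  rintro rfl
  exact h _ (Or.inl rfl) (Or.inl rfl)

open Classical in
lemma gen_apply_mk (e k a b : E) (h : s(a, b) ∈ G.disjointPairs) :
    G.gen e k ⟨s(a, b), h⟩ =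
      (if e = a then if k = b then 1 else 0 else 0) +
        (if e = b then if k = a then 1 else 0 else 0) := by
  have hab : a ≠ b := ne_of_disjoint (G := G) h
  rw [gen_apply]
  simp only [Sym2.eq_iff]
  by_cases h1 : e = a
  · subst h1
    simp [hab]
  · simp [h1, ← ite_and]

open Classical in
lemma delta_apply_mk [Finite E] (e : E) (v : V) (a b : E) (h : s(a, b) ∈ G.disjointPairs) :
    G.delta e v ⟨s(a, b), h⟩ =
      (if e = a then ((if G.init b = v then (1 : ℤ) else 0) -
        (if G.term b = v then 1 else 0)) else 0) +
      (if e = b then ((if G.init a = v then (1 : ℤ) else 0) -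
        (if G.term a = v then 1 else 0)) else 0) := by
  have := Fintype.ofFinite E
  rw [delta_eq_sum, Finsupp.finsetSum_apply]
  simp only [Finsupp.smul_apply, gen_apply_mk, smul_add, Finset.sum_add_distrib]
  congr 1
  · by_cases h1 : e = a <;> simp [h1, -smul_ite]
  · by_cases h1 : e = b <;> simp [h1, -smul_ite]

lemma Subgraph.zRestrict_apply (H : G.Subgraph) (z : G.Z) (p : H.toGraph.disjointPairs) :
    H.zRestrict z p = z (H.pairIncl p) := rfl

lemma Subgraph.zRestrict_delta_mem [Finite E] (H : G.Subgraph) (e : E) (v : V)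
    (hev : ¬ G.Incident e v) : H.zRestrict (G.delta e v) ∈ H.toGraph.B := by
  classical
  by_cases hH : e ∈ H.edges ∧ v ∈ H.verts
  · obtain ⟨he, hv⟩ := hH
    have key : H.zRestrict (G.delta e v) = H.toGraph.delta ⟨e, he⟩ ⟨v, hv⟩ := by
      ext ⟨p, hp⟩
      induction p with
      | _ a b =>
        rw [zRestrict_apply, delta_apply_mk]
        have hp' : s(a.1, b.1) ∈ G.disjointPairs := (H.disjoint_iff a b).1 hp
        change G.delta e v ⟨s(a.1, b.1), hp'⟩ = _
        rw [delta_apply_mk]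
        simp [toGraph, Subtype.ext_iff]
    rw [key]
    exact Submodule.subset_span ⟨_, _, fun h => hev ((H.incident_iff _ _).1 h), rfl⟩
  · have key : H.zRestrict (G.delta e v) = 0 := by
      ext ⟨p, hp⟩
      induction p with
      | _ a b =>
        rw [zRestrict_apply]
        have hp' : s(a.1, b.1) ∈ G.disjointPairs := (H.disjoint_iff a b).1 hp
        change G.delta e v ⟨s(a.1, b.1), hp'⟩ = 0
        rw [delta_apply_mk]
        by_cases he : e ∈ H.edges
        · have hv : v ∉ H.verts := fun hv => hH ⟨he, hv⟩
          have h1 : ∀ k : H.edges, G.init k ≠ v := fun k h => hv (h ▸ H.init_mem k k.2)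
          have h2 : ∀ k : H.edges, G.term k ≠ v := fun k h => hv (h ▸ H.term_mem k k.2)
          simp [h1, h2]
        · have h1 : ∀ k : H.edges, e ≠ k := fun k h => he (h ▸ k.2)
          simp [h1]
    rw [key]
    exact Submodule.zero_mem _

/-- The homomorphism `(i × i)^* : L(G) → L(H)` for the inclusion `i` of a subgraph `H`: it fixes
the class of `E^{e,k}` if `e` and `k` are edges of `H`, and sends it to zero otherwise. -/
def Subgraph.linkingRestrict [Finite E] (H : G.Subgraph) :
    G.LinkingModule →ₗ[ℤ] H.toGraph.LinkingModule :=
  Submodule.mapQ _ _ H.zRestrict (by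
    refine Submodule.span_le.2 ?_
    rintro _ ⟨e, v, hev, rfl⟩
    exact H.zRestrict_delta_mem e v hev)

/-! ### The topological space of a graph -/

variable (G)

/-- The disjoint union of a point for each vertex and a unit interval for each edge. -/
abbrev PreRealization (_G : OrientedGraph V E) := (Σ _ : V, Unit) ⊕ (Σ _ : E, unitInterval)

open Classical in
/-- The normal form of a point under the gluing of the ends of each edge to its initial vertex
(at `0`) and its terminal vertex (at `1`): ends of edges go to vertices, all other points stay. -/
def normalForm : G.PreRealization → G.PreRealization
  | .inl v => .inl v
  | .inr ⟨e, t⟩ =>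
    if t = 0 then .inl ⟨G.init e, ()⟩ else if t = 1 then .inl ⟨G.term e, ()⟩ else .inr ⟨e, t⟩

/-- The equivalence relation that glues the ends of each edge to its vertices. -/
def glue : Setoid G.PreRealization := Setoid.ker G.normalForm

/-- The topological space of `G`, with the quotient topology. -/
def Realization := Quotient G.glue

instance : TopologicalSpace G.Realization :=
  inferInstanceAs (TopologicalSpace (Quotient G.glue))

instance [Finite V] [Finite E] : CompactSpace G.Realization :=
  inferInstanceAs (CompactSpace (Quotient G.glue))

/-- The point with parameter `t` on the edge `e`. -/
def edgePoint (e : E) (t : unitInterval) : G.Realization := Quotient.mk G.glue (.inr ⟨e, t⟩)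

/-- The point that is the vertex `v`. -/
def vertexPoint (v : V) : G.Realization := Quotient.mk G.glue (.inl ⟨v, ()⟩)

lemma continuous_edgePoint (e : E) : Continuous (G.edgePoint e) :=
  continuous_quotient_mk'.comp (continuous_inr.comp continuous_sigmaMk)

lemma edgePoint_zero (e : E) : G.edgePoint e 0 = G.vertexPoint (G.init e) :=
  Quotient.sound (s := G.glue) (by change G.normalForm _ = G.normalForm _; simp [normalForm])

lemma edgePoint_one (e : E) : G.edgePoint e 1 = G.vertexPoint (G.term e) :=
  Quotient.sound (s := G.glue) (by change G.normalForm _ = G.normalForm _; simp [normalForm])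

variable {G}

lemma edgePoint_ne_edgePoint {e k : E} (h : G.DisjointEdges e k) (s t : unitInterval) :
    G.edgePoint e s ≠ G.edgePoint k t := by
  intro hst
  have h0 : G.normalForm _ = G.normalForm _ := Quotient.exact (s := G.glue) hst
  have hne := ne_of_disjoint h
  have h1 := h (G.init e) (Or.inl rfl)
  have h2 := h (G.term e) (Or.inr rfl)
  simp only [Incident, not_or] at h1 h2
  simp only [normalForm] at h0
  split_ifs at h0 <;> simp_all

lemma edgePoint_ne_vertexPoint {e : E} {v : V} (h : ¬ G.Incident e v) (s : unitInterval) :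
    G.edgePoint e s ≠ G.vertexPoint v := by
  intro hst
  have h0 : G.normalForm _ = G.normalForm _ := Quotient.exact (s := G.glue) hst
  simp only [Incident, not_or] at h
  simp only [normalForm] at h0
  split_ifs at h0 <;> simp_all [eq_comm]

namespace Subgraph

variable (H : G.Subgraph)

/-- The inclusion of a subgraph, before gluing. -/
def preIncl : H.toGraph.PreRealization → G.PreRealization :=
  Sum.map (Sigma.map Subtype.val fun _ => id) (Sigma.map Subtype.val fun _ => id)

lemma preIncl_injective : Function.Injective H.preIncl :=
  Function.Injective.sumMap
    (Subtype.val_injective.sigma_map fun _ => Function.injective_id)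
    (Subtype.val_injective.sigma_map fun _ => Function.injective_id)

lemma normalForm_preIncl (x : H.toGraph.PreRealization) :
    G.normalForm (H.preIncl x) = H.preIncl (H.toGraph.normalForm x) := by
  rcases x with v | ⟨e, t⟩
  · rfl
  · simp only [preIncl, Sum.map_inr, Sigma.map, normalForm, id]
    split_ifs <;> rfl

/-- The inclusion `i` of (the space of) a subgraph. -/
def incl : C(H.toGraph.Realization, G.Realization) where
  toFun := Quotient.map' (s₁ := H.toGraph.glue) (s₂ := G.glue) H.preIncl fun x y hxy => by
    change G.normalForm _ = G.normalForm _
    rw [normalForm_preIncl, normalForm_preIncl]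
    exact congrArg _ hxy
  continuous_toFun := by
    refine Continuous.quotient_map' ?_ _
    exact Continuous.sumMap (Continuous.sigma_map fun _ => continuous_id)
      (Continuous.sigma_map fun _ => continuous_id)

lemma incl_injective : Function.Injective H.incl := by
  rintro ⟨x⟩ ⟨y⟩ hxy
  have h0 : G.normalForm (H.preIncl x) = G.normalForm (H.preIncl y) :=
    Quotient.exact (s := G.glue) hxy
  rw [normalForm_preIncl, normalForm_preIncl] at h0
  exact Quotient.sound (s := H.toGraph.glue) (H.preIncl_injective h0)

end Subgraph

/-! ### The homomorphism from `H²(C₂(G), σ)` to `L(G)` -/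

/-- The barycentric coordinate `x i`, as a point of the unit interval. -/
def coord {n : ℕ} (i : Fin (n + 1)) : C(stdSimplex ℝ (Fin (n + 1)), unitInterval) where
  toFun x := ⟨x i, x.2.1 i, by
    rw [← x.2.2]
    exact Finset.single_le_sum (f := fun j => x j) (fun j _ => x.2.1 j) (Finset.mem_univ i)⟩
  continuous_toFun :=
    Continuous.subtype_mk ((continuous_apply i).comp continuous_subtype_val) _

/-- The function `x ↦ x 1 + x 2 = 1 - x 0` on the standard `2`-simplex. -/
def coordSum : C(stdSimplex ℝ (Fin 3), unitInterval) where
  toFun x := unitInterval.symm (coord 0 x)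
  continuous_toFun := by fun_prop

variable (G)

/-- The singular simplex `x ↦ (e (s x), k (t x))` of `C₂(G)`, for disjoint edges `e` and `k`. -/
def edgeSimplex {e k : E} (h : G.DisjointEdges e k) {n : ℕ}
    (s t : C(stdSimplex ℝ (Fin (n + 1)), unitInterval)) : SingSimplex n (Conf G.Realization) where
  toFun x := ⟨(G.edgePoint e (s x), G.edgePoint k (t x)), edgePoint_ne_edgePoint h _ _⟩
  continuous_toFun := Continuous.subtype_mk
    (((G.continuous_edgePoint e).comp s.continuous).prodMk
      ((G.continuous_edgePoint k).comp t.continuous)) _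

/-- The product square `e × k`, for disjoint edges `e` and `k`: the singular chain of `C₂(G)`
formed by the two triangles `(0,0), (1,0), (1,1)` and `(0,0), (0,1), (1,1)` of the unit square,
with signs `+` and `-`. -/
def squareChain {e k : E} (h : G.DisjointEdges e k) : SingChain 2 (Conf G.Realization) :=
  Finsupp.single (G.edgeSimplex h coordSum (coord 2)) 1 -
    Finsupp.single (G.edgeSimplex h (coord 2) coordSum) 1

lemma swap_squareChain {e k : E} (h : G.DisjointEdges e k) :
    chainMap 2 (swap _) (G.squareChain h) = - G.squareChain (G.disjoint_symm.symm _ _ h) := by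
  simp only [squareChain, map_sub, chainMap_single, neg_sub]
  rfl

open Classical in
/-- The chain `(1 - σ_♯) (e × k) = e × k + k × e` of `Ker (1 + σ_♯)`, for disjoint edges `e` and
`k`; zero if the edges are not disjoint. -/
def skewSquare (e k : E) : skewChain G.Realization 2 :=
  if h : G.DisjointEdges e k then
    ⟨G.squareChain h - chainMap 2 (swap _) (G.squareChain h), by
      rw [mem_skewChain, map_sub, swap_squareChain, map_neg, swap_squareChain]
      abel⟩
  else 0

lemma skewSquare_comm (e k : E) : G.skewSquare e k = G.skewSquare k e := by
  by_cases h : G.DisjointEdges e k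
  · have h' := G.disjoint_symm.symm _ _ h
    refine Subtype.ext ?_
    simp only [skewSquare, dif_pos h, dif_pos h', swap_squareChain]
    abel
  · have h' : ¬ G.DisjointEdges k e := fun h' => h (G.disjoint_symm.symm _ _ h')
    simp only [skewSquare, dif_neg h, dif_neg h']

/-- `skewSquare` as a function of the unordered pair of edges. -/
def pairSquare (p : Sym2 E) : skewChain G.Realization 2 :=
  Sym2.lift ⟨G.skewSquare, G.skewSquare_comm⟩ p

/-- The homomorphism that sends a cochain `c` to the sum of the `c (e × k + k × e) • E^{e,k}` over
all unordered pairs of disjoint edges. -/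
def cochainToZ [Finite E] : SkewCochain G.Realization 2 →ₗ[ℤ] G.Z :=
  (Finsupp.linearEquivFunOnFinite ℤ ℤ G.disjointPairs).symm.toLinearMap ∘ₗ
    LinearMap.pi fun p => LinearMap.applyₗ (G.pairSquare p.1)

lemma cochainToZ_mk [Finite E] (c : SkewCochain G.Realization 2) {a b : E}
    (h : s(a, b) ∈ G.disjointPairs) :
    G.cochainToZ c ⟨s(a, b), h⟩ = c (G.skewSquare a b) := rfl

/-- The singular `1`-simplex `e × v` of `C₂(G)`, for a vertex `v` not on the edge `e`. -/
def edgeVertexSimplex {e : E} {v : V} (h : ¬ G.Incident e v) :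
    SingSimplex 1 (Conf G.Realization) where
  toFun x := ⟨(G.edgePoint e (coord 1 x), G.vertexPoint v), edgePoint_ne_vertexPoint h _⟩
  continuous_toFun := Continuous.subtype_mk
    (((G.continuous_edgePoint e).comp (coord 1).continuous).prodMk continuous_const) _

open Classical in
/-- The chain `e × v - v × e` of `Ker (1 + σ_♯)`, for a vertex `v` not on the edge `e`. -/
def skewEdgeVertex (e : E) (v : V) : skewChain G.Realization 1 :=
  if h : ¬ G.Incident e v then
    ⟨Finsupp.single (G.edgeVertexSimplex h) 1 -
        chainMap 1 (swap _) (Finsupp.single (G.edgeVertexSimplex h) 1), by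
      rw [mem_skewChain, map_sub]
      simp only [chainMap_single]
      change Finsupp.single (G.edgeVertexSimplex h) 1 - _ + (_ -
        Finsupp.single (G.edgeVertexSimplex h) 1) = 0
      abel⟩
  else 0

lemma map_succAbove_self {n : ℕ} (i : Fin (n + 2)) (x : stdSimplex ℝ (Fin (n + 1))) :
    stdSimplex.map i.succAbove x i = 0 := by
  rw [stdSimplex.map_coe, FunOnFinite.linearMap_apply_apply]
  exact Finset.sum_eq_zero fun j hj => absurd (Finset.mem_filter.1 hj).2 (Fin.succAbove_ne i j)

lemma map_succAbove_apply {n : ℕ} (i : Fin (n + 2)) (j : Fin (n + 1))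
    (x : stdSimplex ℝ (Fin (n + 1))) :
    stdSimplex.map i.succAbove x (i.succAbove j) = x j := by
  rw [stdSimplex.map_coe, FunOnFinite.linearMap_apply_apply]
  rw [Finset.sum_eq_single j]
  · intro l hl hlj
    exact absurd (Fin.succAbove_right_injective (Finset.mem_filter.1 hl).2) hlj
  · simp

lemma symm_coord_zero (x : stdSimplex ℝ (Fin 2)) : unitInterval.symm (coord 0 x) = coord 1 x := by
  refine Subtype.ext ?_
  change 1 - x 0 = x 1
  have h := x.2.2
  rw [Fin.sum_univ_two] at h
  exact sub_eq_of_eq_add' h.symm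

lemma boundary_squareChain {e k : E} (h : G.DisjointEdges e k)
    (h1 : ¬ G.Incident e (G.init k)) (h2 : ¬ G.Incident e (G.term k))
    (h3 : ¬ G.Incident k (G.init e)) (h4 : ¬ G.Incident k (G.term e)) :
    boundary 1 _ (G.squareChain h) =
      Finsupp.single (G.edgeVertexSimplex h1) 1 - Finsupp.single (G.edgeVertexSimplex h2) 1
      + chainMap 1 (swap _) (Finsupp.single (G.edgeVertexSimplex h4) 1)
      - chainMap 1 (swap _) (Finsupp.single (G.edgeVertexSimplex h3) 1) := by
  have c00 (x : stdSimplex ℝ (Fin 2)) : coord 0 (stdSimplex.map (Fin.succAbove 0) x) = 0 :=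
    Subtype.ext (map_succAbove_self 0 x)
  have c02 (x : stdSimplex ℝ (Fin 2)) :
      coord 2 (stdSimplex.map (Fin.succAbove (0 : Fin 3)) x) = coord 1 x :=
    Subtype.ext (map_succAbove_apply 0 1 x)
  have c10 (x : stdSimplex ℝ (Fin 2)) :
      coord 0 (stdSimplex.map (Fin.succAbove (1 : Fin 3)) x) = coord 0 x :=
    Subtype.ext (map_succAbove_apply 1 0 x)
  have c12 (x : stdSimplex ℝ (Fin 2)) :
      coord 2 (stdSimplex.map (Fin.succAbove (1 : Fin 3)) x) = coord 1 x :=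
    Subtype.ext (map_succAbove_apply 1 1 x)
  have c20 (x : stdSimplex ℝ (Fin 2)) :
      coord 0 (stdSimplex.map (Fin.succAbove (2 : Fin 3)) x) = coord 0 x :=
    Subtype.ext (map_succAbove_apply 2 0 x)
  have c22 (x : stdSimplex ℝ (Fin 2)) :
      coord 2 (stdSimplex.map (Fin.succAbove (2 : Fin 3)) x) = 0 :=
    Subtype.ext (map_succAbove_self 2 x)
  have hA0 : face 0 (G.edgeSimplex h coordSum (coord 2)) =
      (swap _).comp (G.edgeVertexSimplex h4) := by
    ext x : 2
    refine Prod.ext ?_ ?_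
    · refine (congrArg (fun t => G.edgePoint e (unitInterval.symm t)) (c00 x)).trans ?_
      change G.edgePoint e (unitInterval.symm 0) = G.vertexPoint (G.term e)
      rw [unitInterval.symm_zero, edgePoint_one]
    · exact congrArg (G.edgePoint k) (c02 x)
  have hA2 : face 2 (G.edgeSimplex h coordSum (coord 2)) = G.edgeVertexSimplex h1 := by
    ext x : 2
    refine Prod.ext ?_ ?_
    · exact congrArg (G.edgePoint e)
        ((congrArg unitInterval.symm (c20 x)).trans (symm_coord_zero x))
    · refine (congrArg (G.edgePoint k) (c22 x)).trans (G.edgePoint_zero k)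
  have hB0 : face 0 (G.edgeSimplex h (coord 2) coordSum) = G.edgeVertexSimplex h2 := by
    ext x : 2
    refine Prod.ext ?_ ?_
    · exact congrArg (G.edgePoint e) (c02 x)
    · refine (congrArg (fun t => G.edgePoint k (unitInterval.symm t)) (c00 x)).trans ?_
      change G.edgePoint k (unitInterval.symm 0) = G.vertexPoint (G.term k)
      rw [unitInterval.symm_zero, edgePoint_one]
  have hB2 : face 2 (G.edgeSimplex h (coord 2) coordSum) =
      (swap _).comp (G.edgeVertexSimplex h3) := by
    ext x : 2
    refine Prod.ext ?_ ?_
    · refine (congrArg (G.edgePoint e) (c22 x)).trans (G.edgePoint_zero e)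
    · exact congrArg (G.edgePoint k)
        ((congrArg unitInterval.symm (c20 x)).trans (symm_coord_zero x))
  have hAB : face 1 (G.edgeSimplex h coordSum (coord 2)) =
      face 1 (G.edgeSimplex h (coord 2) coordSum) := by
    have hx (x : stdSimplex ℝ (Fin 2)) :
        coordSum (stdSimplex.map (Fin.succAbove (1 : Fin 3)) x) =
          coord 2 (stdSimplex.map (Fin.succAbove (1 : Fin 3)) x) := by
      change unitInterval.symm (coord 0 _) = _
      rw [c10, c12, symm_coord_zero]
    ext x : 2
    exact Prod.ext (congrArg (G.edgePoint e) (hx x)) (congrArg (G.edgePoint k) (hx x).symm)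
  have hb (s : SingSimplex 2 (Conf G.Realization)) : boundary 1 _ (Finsupp.single s 1) =
      Finsupp.single (face 0 s) 1 - Finsupp.single (face 1 s) 1 + Finsupp.single (face 2 s) 1 := by
    refine (boundary_single s).trans ((Fin.sum_univ_three _).trans ?_)
    simp [sub_eq_add_neg]
  rw [squareChain, map_sub, hb, hb, hA0, hA2, hB0, hB2, hAB, chainMap_single, chainMap_single]
  abel

lemma boundary_skewSquare {e k : E} (h : G.DisjointEdges e k) :
    skewBoundary _ 1 (G.skewSquare e k) =
      G.skewEdgeVertex e (G.init k) - G.skewEdgeVertex e (G.term k)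
      + (G.skewEdgeVertex k (G.init e) - G.skewEdgeVertex k (G.term e)) := by
  have h1 : ¬ G.Incident e (G.init k) := fun h' => h _ h' (Or.inl rfl)
  have h2 : ¬ G.Incident e (G.term k) := fun h' => h _ h' (Or.inr rfl)
  have h3 : ¬ G.Incident k (G.init e) := fun h' => h _ (Or.inl rfl) h'
  have h4 : ¬ G.Incident k (G.term e) := fun h' => h _ (Or.inr rfl) h'
  have h' := G.disjoint_symm.symm _ _ h
  have hsq : (G.skewSquare e k : SingChain 2 (Conf G.Realization)) =
      G.squareChain h + G.squareChain h' := by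
    simp only [skewSquare, dif_pos h, swap_squareChain, sub_neg_eq_add]
  refine Subtype.ext ?_
  change boundary 1 _ (G.skewSquare e k : SingChain 2 (Conf G.Realization)) = _
  rw [hsq, map_add, G.boundary_squareChain h h1 h2 h3 h4, G.boundary_squareChain h' h3 h4 h1 h2]
  simp only [skewEdgeVertex, dif_pos h1, dif_pos h2, dif_pos h3, dif_pos h4]
  push_cast
  abel

lemma cochainToZ_coboundary_mem [Finite V] [Finite E] (b : SkewCochain G.Realization 1) :
    G.cochainToZ (coboundary _ 1 b) ∈ G.B := by
  classical
  have := Fintype.ofFinite E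
  have := Fintype.ofFinite V
  have key : G.cochainToZ (coboundary _ 1 b) =
      ∑ e, ∑ v, b (G.skewEdgeVertex e v) • G.delta e v := by
    ext ⟨p, hp⟩
    induction p with
    | _ x y =>
      simp only [Finsupp.finsetSum_apply, Finsupp.smul_apply, delta_apply_mk, smul_add,
        Finset.sum_add_distrib, cochainToZ_mk]
      change b (skewBoundary _ 1 (G.skewSquare x y)) = _
      rw [G.boundary_skewSquare hp]
      simp [mul_sub, Finset.sum_sub_distrib]
  rw [key]
  refine Submodule.sum_mem _ fun e _ => Submodule.sum_mem _ fun v _ => ?_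
  by_cases hev : G.Incident e v
  · simp [skewEdgeVertex, hev]
  · exact Submodule.smul_mem _ _ (Submodule.subset_span ⟨e, v, hev, rfl⟩)

/-- The identification of `H²(C₂(G), σ)` with the linking module `L(G)`: the class of a cocycle
`c` goes to the class of the sum of the `c (e × k + k × e) • E^{e,k}` over all unordered pairs of
disjoint edges. -/
def toLinkingModule [Finite V] [Finite E] : SkewH2 G.Realization →ₗ[ℤ] G.LinkingModule :=
  Submodule.mapQ _ _ (G.cochainToZ ∘ₗ (cocycles G.Realization).subtype) (by
    rintro ⟨c, hc⟩ ⟨b, hb⟩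
    change G.cochainToZ c ∈ G.B
    rw [show c = coboundary _ 1 b from hb.symm]
    exact G.cochainToZ_coboundary_mem b)

end OrientedGraph

/-! ### Spatial embeddings and Wu invariants -/

/-- Euclidean `3`-space. -/
abbrev R3 := EuclideanSpace ℝ (Fin 3)

/-- The `3`-sphere. -/
abbrev S3 := Metric.sphere (0 : EuclideanSpace ℝ (Fin 4)) 1

namespace OrientedGraph

variable {V E : Type*}

/-- An embedding of (the space of) a graph in the `3`-sphere. -/
structure SpatialEmbedding (G : OrientedGraph V E) where
  toMap : C(G.Realization, S3)
  isEmbedding : IsEmbedding toMap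

variable {G : OrientedGraph V E}

namespace SpatialEmbedding

/-- The restriction of a spatial embedding to a subgraph. -/
def restrict [Finite V] [Finite E] (f : G.SpatialEmbedding) (H : G.Subgraph) :
    H.toGraph.SpatialEmbedding where
  toMap := f.toMap.comp H.incl
  isEmbedding := (Continuous.isClosedEmbedding (f.toMap.comp H.incl).continuous
    (f.isEmbedding.injective.comp H.incl_injective)).isEmbedding

/-- A spatial embedding that misses the point `p` of the `3`-sphere, as a map to `3`-space, by
means of a homeomorphism `h` between the complement of `p` and `3`-space. -/
def toR3 (f : G.SpatialEmbedding) {p : S3} (hp : ∀ x, f.toMap x ≠ p) (h : {y : S3 // y ≠ p} ≃ₜ R3) :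
    C(G.Realization, R3) where
  toFun x := h ⟨f.toMap x, hp x⟩
  continuous_toFun := h.continuous.comp (f.toMap.continuous.subtype_mk hp)

lemma toR3_injective (f : G.SpatialEmbedding) {p : S3} (hp : ∀ x, f.toMap x ≠ p)
    (h : {y : S3 // y ≠ p} ≃ₜ R3) : Function.Injective (f.toR3 hp h) :=
  fun _ _ hxy => f.isEmbedding.injective (congrArg Subtype.val (h.injective hxy))

/-- The Wu invariant `ℒ(f) ∈ L(G)`: the element `(f × f)^* Σ` of `H²(C₂(G), σ) ≅ L(G)`, where
`Σ` (here `S`) is a generator of `H²(C₂(ℝ³), σ)`. It is determined up to the sign that comes from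
the choice of the generator `±Σ` and from the orientation character of `h`. -/
def wuInvariant [Finite V] [Finite E] (S : SkewH2 R3) (f : G.SpatialEmbedding) {p : S3}
    (hp : ∀ x, f.toMap x ≠ p) (h : {y : S3 // y ≠ p} ≃ₜ R3) : G.LinkingModule :=
  G.toLinkingModule (pullback (f.toR3 hp h) (f.toR3_injective hp h) S)

/-- The reduced Wu invariant of `f` with respect to `ε`. -/
def reducedWu [Finite V] [Finite E] (S : SkewH2 R3) (f : G.SpatialEmbedding) {p : S3}
    (hp : ∀ x, f.toMap x ≠ p) (h : {y : S3 // y ≠ p} ≃ₜ R3) (ε : G.LinkingModule →ₗ[ℤ] ℤ) : ℤ :=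
  ε (f.wuInvariant S hp h)

lemma restrict_ne [Finite V] [Finite E] (f : G.SpatialEmbedding) (H : G.Subgraph) {p : S3}
    (hp : ∀ x, f.toMap x ≠ p) : ∀ x, (f.restrict H).toMap x ≠ p :=
  fun x => hp (H.incl x)

end SpatialEmbedding
end OrientedGraph
end SpatialGraph

end

/-! ### Functoriality of skew-symmetric cohomology. -/

namespace SpatialGraph

/-! The content is naturality: the Wu invariant of a restricted embedding is the restriction of the
Wu invariant, $\mathcal L(f|_H) = (i\times i)^*\mathcal L(f)$ for the inclusion $i$ of a subgraph
$H$ (`wuInvariant_restrict`). Once this is known, applying $\varepsilon_q$, multiplying by $m_q$ and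
summing over $q$ gives the formula, since $\varepsilon$ is by definition the same combination of the
$\varepsilon_q\circ(i_q\times i_q)^*$.

Naturality has two sources. Since $f|_H = f\circ i$, contravariance of the pullback
(`pullback_pullback`) gives $(f|_H\times f|_H)^*\Sigma = (i\times i)^*(f\times f)^*\Sigma$. The
pullback must then be compared with the combinatorial restriction $L(G)\to L(H)$
(`linkingRestrict_toLinkingModule`). Here $i\times i$ carries the singular square $e\times k$ of $H$
exactly onto the square $e\times k$ of $G$. A cochain pulled back to $H$ therefore has on each
square of $H$ the value that the original cochain has on the same square of $G$, and the squares of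
$G$ that involve an edge outside $H$ are never evaluated. This is the map of free modules that keeps
$E^{e,k}$ for edges of $H$ and kills the others. The comparison is an equality of cochain values in
$Z(H)$, so no relation of $B(H)$ enters it. -/

lemma chainMap_chainMap {X Y W : Type*} [TopologicalSpace X] [TopologicalSpace Y]
    [TopologicalSpace W] {n : ℕ} (g : C(Y, W)) (f : C(X, Y)) (c : SingChain n X) :
    chainMap n g (chainMap n f c) = chainMap n (g.comp f) c := by
  suffices h : (chainMap n g).comp (chainMap n f) = chainMap n (g.comp f) from
    LinearMap.congr_fun h c
  refine Finsupp.lhom_ext' fun s => LinearMap.ext_ring ?_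
  simp only [LinearMap.comp_apply, Finsupp.lsingle_apply, chainMap_single,
    ContinuousMap.comp_assoc]

lemma skewMap_skewMap {X Y W : Type*} [TopologicalSpace X] [TopologicalSpace Y]
    [TopologicalSpace W] (n : ℕ) (g : C(Y, W)) (hg : Function.Injective g) (f : C(X, Y))
    (hf : Function.Injective f) (c : skewChain X n) :
    skewMap n g hg (skewMap n f hf c) = skewMap n (g.comp f) (hg.comp hf) c :=
  -- `confMap` of a composite is definitionally the composite of the `confMap`s.
  Subtype.ext (chainMap_chainMap _ _ _)

lemma pullback_pullback {X Y W : Type*} [TopologicalSpace X] [TopologicalSpace Y]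
    [TopologicalSpace W] (g : C(Y, W)) (hg : Function.Injective g) (f : C(X, Y))
    (hf : Function.Injective f) (x : SkewH2 W) :
    pullback f hf (pullback g hg x) = pullback (g.comp f) (hg.comp hf) x := by
  obtain ⟨c, rfl⟩ := Submodule.Quotient.mk_surjective _ x
  -- Both sides are classes of explicit cocycles, and these already agree as cochains; no coboundary
  -- is needed to compare them.
  refine congrArg Submodule.Quotient.mk (Subtype.ext (LinearMap.ext fun y => ?_))
  exact congrArg c.1 (skewMap_skewMap 2 g hg f hf y)

/-! ### Naturality of the map to the linking module. -/

namespace OrientedGraph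

variable {V E : Type*} {G : OrientedGraph V E}

/-- The inclusion keeps the parameter on every edge, and both squares are cut along the same
diagonal with the same signs, so the triangles match one by one. -/
lemma Subgraph.chainMap_incl_squareChain (H : G.Subgraph) {e k : H.edges}
    (h : H.toGraph.DisjointEdges e k) :
    chainMap 2 (confMap H.incl H.incl_injective) (H.toGraph.squareChain h) =
      G.squareChain ((H.disjoint_iff e k).1 h) := by
  simp only [squareChain, map_sub, chainMap_single]
  -- The inclusion sends the class of `(e, t)` to the class of `(e.1, t)` by computation in the
  -- quotient.
  rfl

lemma Subgraph.skewMap_incl_skewSquare (H : G.Subgraph) {e k : H.edges}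
    (h : H.toGraph.DisjointEdges e k) :
    skewMap 2 H.incl H.incl_injective (H.toGraph.skewSquare e k) = G.skewSquare e k := by
  refine Subtype.ext ?_
  have h' := (H.disjoint_iff e k).1 h
  change chainMap 2 (confMap H.incl H.incl_injective) (H.toGraph.skewSquare e k).1 = _
  -- Disjointness in $H$ and in $G$ agree, so neither skew square is the default value `0`.
  -- Rewriting $-\sigma_\sharp(e\times k)$ as $k\times e$ leaves only squares, to which the previous
  -- lemma applies.
  simp only [skewSquare, dif_pos h, dif_pos h', swap_squareChain, map_sub, map_neg,
    H.chainMap_incl_squareChain]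

/-- The coefficient at a pair $\{a,b\}$ of edges of $H$ is, on both sides, the value of `c` on the
skew square of $a$ and $b$ in $G$. -/
lemma Subgraph.zRestrict_cochainToZ [Finite E] (H : G.Subgraph)
    (c : SkewCochain G.Realization 2) :
    H.zRestrict (G.cochainToZ c) =
      H.toGraph.cochainToZ (c ∘ₗ skewMap 2 H.incl H.incl_injective) := by
  ext ⟨p, hp⟩
  induction p with
  | _ a b => exact congrArg c (H.skewMap_incl_skewSquare hp).symm

/-- The homomorphism `(i × i)^*` of linking modules is the one that the inclusion induces on
cohomology. -/
lemma Subgraph.linkingRestrict_toLinkingModule [Finite V] [Finite E] (H : G.Subgraph)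
    (x : SkewH2 G.Realization) :
    H.linkingRestrict (G.toLinkingModule x) =
      H.toGraph.toLinkingModule (pullback H.incl H.incl_injective x) := by
  obtain ⟨c, rfl⟩ := Submodule.Quotient.mk_surjective _ x
  -- All the maps are induced on quotients, so on a representing cocycle the claim is the identity
  -- in $Z(H)$.
  exact congrArg Submodule.Quotient.mk (H.zRestrict_cochainToZ c.1)

/-- Naturality of the Wu invariant. The same `p` and `h` serve for `f` and its restriction, so the
two maps to `R3` differ only by precomposition with the inclusion. -/
lemma SpatialEmbedding.wuInvariant_restrict [Finite V] [Finite E] (S : SkewH2 R3)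
    (f : G.SpatialEmbedding) (H : G.Subgraph) {p : S3} (hp : ∀ x, f.toMap x ≠ p)
    (h : {y : S3 // y ≠ p} ≃ₜ R3) :
    (f.restrict H).wuInvariant S (f.restrict_ne H hp) h =
      H.linkingRestrict (f.wuInvariant S hp h) := by
  rw [wuInvariant, wuInvariant, H.linkingRestrict_toLinkingModule, pullback_pullback]
  -- What remains is that `(f.restrict H).toR3` is `f.toR3` composed with `H.incl`, which holds
  -- pointwise by definition.
  rfl

end OrientedGraph
end SpatialGraph

/-! ### Integer combinations of reduced Wu invariants of subgraphs. -/

theorem theorem4p1 {V E : Type*} [Finite V] [Finite E] (G : SpatialGraph.OrientedGraph V E)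
    {k : ℕ} (H : Fin k → G.Subgraph)
    (εq : ∀ q, (H q).toGraph.LinkingModule →ₗ[ℤ] ℤ) (m : Fin k → ℤ)
    (ε : G.LinkingModule →ₗ[ℤ] ℤ) (hε : ε = ∑ q, m q • (εq q ∘ₗ (H q).linkingRestrict))
    (S : SpatialGraph.SkewH2 SpatialGraph.R3) (hS : Submodule.span ℤ {S} = ⊤) :
    (∀ q, ∀ x : SpatialGraph.SkewH2 G.Realization,
      (H q).linkingRestrict (G.toLinkingModule x) =
        (H q).toGraph.toLinkingModule
          (SpatialGraph.pullback (H q).incl (H q).incl_injective x)) ∧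
    ∀ (f : G.SpatialEmbedding) (p : SpatialGraph.S3) (hp : ∀ x, f.toMap x ≠ p)
      (h : {y : SpatialGraph.S3 // y ≠ p} ≃ₜ SpatialGraph.R3),
      ∑ q, m q * (f.restrict (H q)).reducedWu S (f.restrict_ne (H q) hp) h (εq q) =
        f.reducedWu S hp h ε := by
  refine ⟨fun q x => (H q).linkingRestrict_toLinkingModule x, fun f p hp h => ?_⟩
  subst hε
  simp only [SpatialGraph.OrientedGraph.SpatialEmbedding.reducedWu, LinearMap.sum_apply,
    LinearMap.smul_apply, LinearMap.comp_apply, smul_eq_mul]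
  -- With $\varepsilon$ expanded, the sums agree term by term: the $q$-th terms are
  -- $m_q\varepsilon_q$ of the two sides of naturality for $G_q$.
  exact Finset.sum_congr rfl fun q _ => congrArg (fun z => m q * εq q z)
    (f.wuInvariant_restrict S (H q) hp h)
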